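/- Throughout, $\log$ is the logarithm to base $2$. For a nonzero $f\in\mathbb{C}[X]$ let $V_{\mathbb{C}}(f)$ be the set of its distinct complex roots and $\operatorname{mult}(z,f)$ the multiplicity of $z$ as a root of $f$. For $z\in V_{\mathbb{C}}(f)$ put $\operatorname{sep}(z,f)=\min\{|y-z| : y\in V_{\mathbb{C}}(f),\ y\neq z\}$, and define $$\operatorname{logsep}(f)=\max\Bigl(1,\sum_{z\in V_{\mathbb{C}}(f)}\operatorname{mult}(z,f)\cdot|\log\operatorname{sep}(z,f)|\Bigr),\qquad \operatorname{logsep}^\star(f)=\operatorname{logsep}(f^\star)=\max\Bigl(1,\sum_{z\in V_{\mathbb{C}}(f)}|\log\operatorname{sep}(z,f)|\Bigr),$$ where $f^\star=\operatorname{lc}(f)\prod_{z\in V_{\mathbb{C}}(f)}(X-z)$ is the square-free part of $f$ and $\operatorname{lc}(f)$ its leading coefficient. (If $f$ has at most one distinct root, the sums are taken to be $0$, so that both quantities equal $1$.) A polynomial $f\in\mathbb{Z}[X]$ is of magnitude $(n,\tau)$ if its degree is at most $n$ and each of its coefficients is at most $2^\tau$ in absolute value. Then there are absolute constants $C>0$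 and $k\in\mathbb{N}$ such that for every integer $n\ge 1$, every real $\tau\ge 1$ and every nonzero $f\in\mathbb{Z}[X]$ of magnitude $(n,\tau)$: (a) $\operatorname{logsep}^\star(f)\le C\, n\tau\,\log^k(2+n\tau)$, that is, $\operatorname{logsep}^\star(f)\in\tilde O(n\tau)$; (b) $\operatorname{logsep}(f)\le C\,(n\tau+n^2)\,\log^k(2+n\tau+n^2)$, that is, $\operatorname{logsep}(f)\in\tilde O(n\tau+n^2)$. -/

import Mathlib

open Polynomial

namespace RootSep

noncomputable section

/-- `V_ℂ(f)`: the finite set of distinct complex roots of a nonzero polynomial `f`. -/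
def roots (f : ℂ[X]) : Finset ℂ := f.roots.toFinset

/-- `sep(z, f)`: the least distance from `z` to a root of `f` different from `z`.
If `f` has no such root then the infimum is over the empty set, and `sep f z = 0`; as
`Real.logb 2 0 = 0`, such a `z` contributes `0` to `logsep`. -/
def sep (f : ℂ[X]) (z : ℂ) : ℝ :=
  sInf ((fun y : ℂ => ‖y - z‖) '' {y : ℂ | y ∈ roots f ∧ y ≠ z})

/-- `logsep(f) = max(1, ∑ mult(z, f) · |log sep(z, f)|)`, the sum over the distinct roots `z`. -/
def logsep (f : ℂ[X]) : ℝ :=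
  max 1 (∑ z ∈ roots f, (f.rootMultiplicity z : ℝ) * |Real.logb 2 (sep f z)|)

/-- The square-free part `f⋆ = lc(f) · ∏ (X - z)`, the product over the distinct roots `z`. -/
def squarefreePart (f : ℂ[X]) : ℂ[X] :=
  C f.leadingCoeff * ∏ z ∈ roots f, (X - C z)

/-- `logsep⋆(f) = logsep(f⋆)`. -/
def logsepStar (f : ℂ[X]) : ℝ := logsep (squarefreePart f)

/-- `f ∈ ℤ[X]` is of magnitude `(n, τ)`: its degree is at most `n` and its coefficients are
bounded by `2 ^ τ` in absolute value. -/
def HasMagnitude (f : ℤ[X]) (n : ℕ) (τ : ℝ) : Prop :=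
  f.natDegree ≤ n ∧ ∀ i : ℕ, |(f.coeff i : ℝ)| ≤ (2 : ℝ) ^ τ

theorem roots_multiset_squarefreePart {f : ℂ[X]} (hf : f ≠ 0) :
    (squarefreePart f).roots = (roots f).val := by
  rw [squarefreePart, roots_C_mul _ (leadingCoeff_ne_zero.mpr hf), roots_prod_X_sub_C]

theorem roots_squarefreePart {f : ℂ[X]} (hf : f ≠ 0) :
    roots (squarefreePart f) = roots f := by
  rw [roots, roots_multiset_squarefreePart hf, Finset.val_toFinset]

/-- `logsep⋆(f) = max(1, ∑ |log sep(z, f)|)`, the sum over the distinct roots `z` of `f`. -/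
theorem logsepStar_eq {f : ℂ[X]} (hf : f ≠ 0) :
    logsepStar f = max 1 (∑ z ∈ roots f, |Real.logb 2 (sep f z)|) := by
  have hs : ∀ z, sep (squarefreePart f) z = sep f z := fun z => by
    rw [sep, sep, roots_squarefreePart hf]
  rw [logsepStar, logsep, roots_squarefreePart hf]
  congr 1
  refine Finset.sum_congr rfl fun z hz => ?_
  rw [hs, ← count_roots, roots_multiset_squarefreePart hf,
    Multiset.count_eq_one_of_mem (roots f).nodup hz, Nat.cast_one, one_mul]

end

end RootSep

/-! Write M(f) for the Mahler measure and d for the degree. Since log M(f) ≤ log(n+1) + τ log 2, it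
suffices to bound both sums in terms of d and log M(f). A separation is at most 2M(f)², so large
separations cost at most d(log 2 + 2 log M(f)) altogether. The difficulty is that many roots may be
close to other roots.

The arithmetic input is that resultants of coprime integer polynomials are nonzero integers. The
logarithmic quantity `pairEnergy` is additive in each argument, so `pairEnergy_nonneg` reduces to
irreducible factors, where it is a resultant or, for a repeated factor, a discriminant in disguise.
For `p = q = f` this bounds below the sum of log|x - y| over all pairs of distinct roots, weighted
by multiplicities, although the discriminant of f may vanish (`logEnergy_roots_ge`).

For (b), each log|x - y| is normalised to be nonpositive (`chordLog`). The term of a nearest root is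
then at least the sum over all roots; summing over z leaves the energy and an error d² log 2, which
is the n².

For (a) that error is too large. An integer divisor g of f with the same roots, all simple, replaces
f, and the Davenport–Mahler argument applies: in the Vandermonde matrix of the roots, subtracting
from each row the row of its nearest neighbour extracts all the small separations at once
(`sum_neg_log_le`). The Leibniz bound on the remaining determinant costs only O(d log d). -/

namespace RootSep

/-! ### Logarithmic energy of root multisets -/

/-- The sum of `log ‖x - y‖` over `x ∈ s`, `y ∈ t`. Coincident pairs contribute `log 0 = 0`. -/
noncomputable def logEnergy (s t : Multiset ℂ) : ℝ :=
  (s.map fun x => (t.map fun y => Real.log ‖x - y‖).sum).sum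

theorem logEnergy_add_left (s s' t : Multiset ℂ) :
    logEnergy (s + s') t = logEnergy s t + logEnergy s' t := by
  simp [logEnergy]

theorem logEnergy_add_right (s t t' : Multiset ℂ) :
    logEnergy s (t + t') = logEnergy s t + logEnergy s t' := by
  simp [logEnergy]

theorem log_norm_prod_map_sub {x : ℂ} {s : Multiset ℂ} (h : (s.map (x - ·)).prod ≠ 0) :
    Real.log ‖(s.map (x - ·)).prod‖ = (s.map fun y => Real.log ‖x - y‖).sum := by
  induction s using Multiset.induction_on with
  | empty => simp
  | cons y s ih =>
    simp only [Multiset.map_cons, Multiset.prod_cons, Multiset.sum_cons] at h ⊢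
    rw [norm_mul, Real.log_mul (norm_ne_zero_iff.mpr (left_ne_zero_of_mul h))
      (norm_ne_zero_iff.mpr (right_ne_zero_of_mul h)), ih (right_ne_zero_of_mul h)]

theorem log_norm_eval {q : ℂ[X]} {x : ℂ} (h : q.eval x ≠ 0) :
    Real.log ‖q.eval x‖ =
      Real.log ‖q.leadingCoeff‖ + (q.roots.map fun y => Real.log ‖x - y‖).sum := by
  have e := (IsAlgClosed.splits q).eval_eq_prod_roots x
  rw [e] at h ⊢
  rw [norm_mul, Real.log_mul (norm_ne_zero_iff.mpr (left_ne_zero_of_mul h))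
    (norm_ne_zero_iff.mpr (right_ne_zero_of_mul h)),
    log_norm_prod_map_sub (right_ne_zero_of_mul h)]

theorem eval_derivative_of_mem_roots {p : ℂ[X]} {x : ℂ} (hx : x ∈ p.roots) :
    p.derivative.eval x = p.leadingCoeff * ((p.roots.erase x).map (x - ·)).prod := by
  conv_lhs => rw [(IsAlgClosed.splits p).eq_prod_roots]
  rw [derivative_C_mul, eval_mul, eval_C, eval_multiset_prod_X_sub_C_derivative hx]

theorem log_norm_eval_derivative {p : ℂ[X]} {x : ℂ} (hx : x ∈ p.roots)
    (h : p.derivative.eval x ≠ 0) :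
    Real.log ‖p.derivative.eval x‖ =
      Real.log ‖p.leadingCoeff‖ + (p.roots.map fun y => Real.log ‖x - y‖).sum := by
  rw [eval_derivative_of_mem_roots hx] at h ⊢
  rw [norm_mul, Real.log_mul (norm_ne_zero_iff.mpr (left_ne_zero_of_mul h))
    (norm_ne_zero_iff.mpr (right_ne_zero_of_mul h)),
    log_norm_prod_map_sub (right_ne_zero_of_mul h)]
  -- The erased copy of `x` would contribute log 0 = 0, so the sum may run over all roots.
  conv_rhs => rw [← Multiset.cons_erase hx]
  simp

/-! ### Integer polynomials -/

/-- An integer polynomial viewed over `ℂ`. -/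
noncomputable abbrev toComplex (p : ℤ[X]) : ℂ[X] := p.map (Int.castRingHom ℂ)

theorem intCast_injective : Function.Injective (Int.castRingHom ℂ) :=
  (Int.castRingHom ℂ).injective_int

theorem toComplex_ne_zero {p : ℤ[X]} (hp : p ≠ 0) : toComplex p ≠ 0 :=
  (Polynomial.map_ne_zero_iff intCast_injective).mpr hp

theorem leadingCoeff_toComplex (p : ℤ[X]) :
    (toComplex p).leadingCoeff = (p.leadingCoeff : ℂ) :=
  leadingCoeff_map_of_injective intCast_injective p

theorem natDegree_toComplex (p : ℤ[X]) : (toComplex p).natDegree = p.natDegree :=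
  natDegree_map_eq_of_injective intCast_injective p

theorem card_roots_toComplex (p : ℤ[X]) : (toComplex p).roots.card = p.natDegree := by
  rw [← (IsAlgClosed.splits (toComplex p)).natDegree_eq_card_roots, natDegree_toComplex]

theorem roots_toComplex_mul {p q : ℤ[X]} (hp : p ≠ 0) (hq : q ≠ 0) :
    (toComplex (p * q)).roots = (toComplex p).roots + (toComplex q).roots := by
  rw [toComplex, Polynomial.map_mul]
  exact roots_mul (mul_ne_zero (toComplex_ne_zero hp) (toComplex_ne_zero hq))

theorem one_le_norm_intCast {a : ℤ} (ha : a ≠ 0) : (1 : ℝ) ≤ ‖(a : ℂ)‖ := by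
  rw [Complex.norm_intCast]
  exact_mod_cast Int.one_le_abs ha

theorem one_le_norm_leadingCoeff {p : ℤ[X]} (hp : p ≠ 0) :
    1 ≤ ‖(toComplex p).leadingCoeff‖ := by
  rw [leadingCoeff_toComplex]
  exact one_le_norm_intCast (leadingCoeff_ne_zero.mpr hp)

theorem log_leadingCoeff_nonneg {p : ℤ[X]} (hp : p ≠ 0) :
    0 ≤ Real.log ‖(toComplex p).leadingCoeff‖ :=
  Real.log_nonneg (one_le_norm_leadingCoeff hp)

theorem eval_ne_zero_of_isCoprime {p q : ℂ[X]} (h : IsCoprime p q) {x : ℂ} (hx : x ∈ p.roots) :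
    q.eval x ≠ 0 := by
  intro h0
  obtain ⟨a, b, hab⟩ := h
  have := congrArg (eval x) hab
  simp [(mem_roots'.mp hx).2.eq_zero, h0] at this

/-- The resultant of two coprime integer polynomials is a nonzero integer. -/
theorem sum_log_norm_eval_nonneg {p q : ℤ[X]}
    (h : IsCoprime (toComplex p) (toComplex q)) :
    0 ≤ q.natDegree * Real.log ‖(toComplex p).leadingCoeff‖ +
      ((toComplex p).roots.map fun x => Real.log ‖(toComplex q).eval x‖).sum := by
  have hres := resultant_eq_prod_eval (toComplex p) (toComplex q) (toComplex q).natDegree le_rfl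
    (IsAlgClosed.splits _)
  have hne := resultant_ne_zero _ _ h
  have hint : resultant (toComplex p) (toComplex q) = ((resultant p q : ℤ) : ℂ) := by
    rw [natDegree_toComplex, natDegree_toComplex, resultant_map_map]; rfl
  have h1 : 1 ≤ ‖resultant (toComplex p) (toComplex q)‖ := by
    rw [hint] at hne ⊢
    exact one_le_norm_intCast (by exact_mod_cast hne)
  rw [hres] at h1 hne
  have hlog := Real.log_nonneg h1
  have hev : ∀ s : Multiset ℂ, (s.map (toComplex q).eval).prod ≠ 0 →
      Real.log ‖(s.map (toComplex q).eval).prod‖ =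
        (s.map fun x => Real.log ‖(toComplex q).eval x‖).sum := by
    intro s
    induction s using Multiset.induction_on with
    | empty => simp
    | cons y s ih =>
      intro h
      simp only [Multiset.map_cons, Multiset.prod_cons, Multiset.sum_cons] at h ⊢
      rw [norm_mul, Real.log_mul (norm_ne_zero_iff.mpr (left_ne_zero_of_mul h))
        (norm_ne_zero_iff.mpr (right_ne_zero_of_mul h)), ih (right_ne_zero_of_mul h)]
  rwa [norm_mul, Real.log_mul (norm_ne_zero_iff.mpr (left_ne_zero_of_mul hne))
    (norm_ne_zero_iff.mpr (right_ne_zero_of_mul hne)), hev _ (right_ne_zero_of_mul hne),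
    norm_pow, Real.log_pow, natDegree_toComplex] at hlog

/-- The logarithm of `|lc p| ^ deg q * |lc q| ^ deg p * ∏ |x - y|`, over the roots `x` of `p`
and the roots `y ≠ x` of `q`. -/
noncomputable def pairEnergy (p q : ℤ[X]) : ℝ :=
  q.natDegree * Real.log ‖(toComplex p).leadingCoeff‖ +
    p.natDegree * Real.log ‖(toComplex q).leadingCoeff‖ +
    logEnergy (toComplex p).roots (toComplex q).roots

theorem log_leadingCoeff_mul {p q : ℤ[X]} (hp : p ≠ 0) (hq : q ≠ 0) :
    Real.log ‖(toComplex (p * q)).leadingCoeff‖ =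
      Real.log ‖(toComplex p).leadingCoeff‖ + Real.log ‖(toComplex q).leadingCoeff‖ := by
  rw [toComplex, Polynomial.map_mul, leadingCoeff_mul, norm_mul, Real.log_mul]
  · exact norm_ne_zero_iff.mpr (leadingCoeff_ne_zero.mpr (toComplex_ne_zero hp))
  · exact norm_ne_zero_iff.mpr (leadingCoeff_ne_zero.mpr (toComplex_ne_zero hq))

/-- The leading coefficients carry exactly the exponents of a resultant, which makes the quantity
additive. Unlike for the resultant itself, a common root does no harm, because log 0 = 0. -/
theorem pairEnergy_mul_left {p p' q : ℤ[X]} (hp : p ≠ 0) (hp' : p' ≠ 0) :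
    pairEnergy (p * p') q = pairEnergy p q + pairEnergy p' q := by
  rw [pairEnergy, pairEnergy, pairEnergy, log_leadingCoeff_mul hp hp', roots_toComplex_mul hp hp',
    logEnergy_add_left, natDegree_mul hp hp']
  push_cast
  ring

theorem pairEnergy_mul_right {p q q' : ℤ[X]} (hq : q ≠ 0) (hq' : q' ≠ 0) :
    pairEnergy p (q * q') = pairEnergy p q + pairEnergy p q' := by
  rw [pairEnergy, pairEnergy, pairEnergy, log_leadingCoeff_mul hq hq', roots_toComplex_mul hq hq',
    logEnergy_add_right, natDegree_mul hq hq']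
  push_cast
  ring

theorem pairEnergy_nonneg_of_isCoprime {p q : ℤ[X]}
    (h : IsCoprime (toComplex p) (toComplex q)) : 0 ≤ pairEnergy p q := by
  have h0 := sum_log_norm_eval_nonneg h
  rw [Multiset.map_congr rfl fun x hx => log_norm_eval (eval_ne_zero_of_isCoprime h hx),
    Multiset.sum_map_add, Multiset.map_const', Multiset.sum_replicate, card_roots_toComplex,
    nsmul_eq_mul] at h0
  rw [pairEnergy, logEnergy]
  linarith

/-- At a simple root, p' equals lc(p) times the product of the differences to the other roots, so
this is the integrality of the resultant of p and p'. -/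
theorem pairEnergy_self_nonneg_of_isCoprime_derivative {p : ℤ[X]} (hp : p ≠ 0)
    (h : IsCoprime (toComplex p) (derivative (toComplex p))) : 0 ≤ pairEnergy p p := by
  have hd : derivative (toComplex p) = toComplex (derivative p) := by
    rw [toComplex, derivative_map]
  have h0 := sum_log_norm_eval_nonneg (hd ▸ h)
  rw [← hd, Multiset.map_congr rfl fun x hx =>
      log_norm_eval_derivative hx (eval_ne_zero_of_isCoprime h hx),
    Multiset.sum_map_add, Multiset.map_const', Multiset.sum_replicate, card_roots_toComplex,
    nsmul_eq_mul] at h0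
  -- The resultant has the exponent deg p' on the leading coefficient; raising it to deg p is
  -- harmless since |lc p| ≥ 1.
  have hle : ((derivative p).natDegree : ℝ) ≤ p.natDegree := by
    exact_mod_cast (natDegree_derivative_le p).trans (Nat.sub_le _ _)
  have := mul_le_mul_of_nonneg_right hle (log_leadingCoeff_nonneg hp)
  rw [pairEnergy, logEnergy]
  linarith

/-! ### Passing through `ℚ` -/

/-- An integer polynomial viewed over `ℚ`. -/
noncomputable abbrev toRat (p : ℤ[X]) : ℚ[X] := p.map (Int.castRingHom ℚ)

theorem map_toRat (p : ℤ[X]) : (toRat p).map (algebraMap ℚ ℂ) = toComplex p := by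
  rw [toRat, Polynomial.map_map, toComplex]
  congr 1

theorem irreducible_toRat {p : ℤ[X]} (hp : Irreducible p) (hd : p.natDegree ≠ 0) :
    Irreducible (toRat p) :=
  (IsPrimitive.Int.irreducible_iff_irreducible_map_cast (hp.isPrimitive hd)).mp hp

theorem isCoprime_derivative_of_irreducible {p : ℤ[X]} (hp : Irreducible p)
    (hd : p.natDegree ≠ 0) : IsCoprime (toComplex p) (derivative (toComplex p)) := by
  have := (irreducible_toRat hp hd).separable.map (f := algebraMap ℚ ℂ)
  rwa [map_toRat] at this

theorem isCoprime_toComplex_or_dvd {p q : ℤ[X]} (hp : Irreducible p) (hd : p.natDegree ≠ 0) :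
    toRat p ∣ toRat q ∨ IsCoprime (toComplex p) (toComplex q) := by
  refine (dvd_or_isCoprime _ _ (irreducible_toRat hp hd)).imp_right fun h => ?_
  rw [← map_toRat, ← map_toRat]
  exact (isCoprime_map _).mpr h

theorem roots_eq_of_associated {p q : ℤ[X]} (h : Associated (toRat p) (toRat q)) :
    (toComplex p).roots = (toComplex q).roots := by
  have h' : Associated (toComplex p) (toComplex q) := by
    rw [← map_toRat, ← map_toRat]
    exact h.map (mapRingHom (algebraMap ℚ ℂ))
  obtain ⟨u, hu⟩ := h'
  obtain ⟨c, hc, hcu⟩ := isUnit_iff.mp u.isUnit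
  rw [← hu, ← hcu, mul_comm, roots_C_mul _ hc.ne_zero]

theorem roots_eq_zero_of_natDegree_eq_zero {p : ℤ[X]} (h : p.natDegree = 0) :
    (toComplex p).roots = 0 := by
  rw [← Multiset.card_eq_zero, card_roots_toComplex, h]

theorem pairEnergy_nonneg_of_natDegree_eq_zero_left {p q : ℤ[X]} (hp : p ≠ 0)
    (hd : p.natDegree = 0) : 0 ≤ pairEnergy p q := by
  have := mul_nonneg (Nat.cast_nonneg (α := ℝ) q.natDegree) (log_leadingCoeff_nonneg hp)
  rw [pairEnergy, roots_eq_zero_of_natDegree_eq_zero hd, hd]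
  simpa [logEnergy] using this

theorem pairEnergy_nonneg_of_natDegree_eq_zero_right {p q : ℤ[X]} (hq : q ≠ 0)
    (hd : q.natDegree = 0) : 0 ≤ pairEnergy p q := by
  have := mul_nonneg (Nat.cast_nonneg (α := ℝ) p.natDegree) (log_leadingCoeff_nonneg hq)
  rw [pairEnergy, roots_eq_zero_of_natDegree_eq_zero hd, hd]
  simpa [logEnergy] using this

theorem pairEnergy_nonneg_of_irreducible {p q : ℤ[X]} (hp : Irreducible p) (hq : Irreducible q) :
    0 ≤ pairEnergy p q := by
  by_cases hpd : p.natDegree = 0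
  · exact pairEnergy_nonneg_of_natDegree_eq_zero_left hp.ne_zero hpd
  by_cases hqd : q.natDegree = 0
  · exact pairEnergy_nonneg_of_natDegree_eq_zero_right hq.ne_zero hqd
  rcases isCoprime_toComplex_or_dvd (q := q) hp hpd with h | h
  -- Here p and q have the same roots, so `pairEnergy p q` is the mean of `pairEnergy p p` and
  -- `pairEnergy q q`, whatever the leading coefficients are.
  · have ha := (irreducible_toRat hp hpd).associated_of_dvd (irreducible_toRat hq hqd) h
    have hr := roots_eq_of_associated ha
    have hdeg : p.natDegree = q.natDegree := by
      rw [← card_roots_toComplex, hr, card_roots_toComplex]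
    have h1 := pairEnergy_self_nonneg_of_isCoprime_derivative hp.ne_zero
      (isCoprime_derivative_of_irreducible hp hpd)
    have h2 := pairEnergy_self_nonneg_of_isCoprime_derivative hq.ne_zero
      (isCoprime_derivative_of_irreducible hq hqd)
    rw [pairEnergy] at h1 h2 ⊢
    rw [hr, hdeg] at h1 ⊢
    linarith
  · exact pairEnergy_nonneg_of_isCoprime h

theorem pairEnergy_nonneg {p q : ℤ[X]} (hp : p ≠ 0) (hq : q ≠ 0) : 0 ≤ pairEnergy p q := by
  induction p using WfDvdMonoid.induction_on_irreducible with
  | zero => exact absurd rfl hp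
  | unit u hu => exact pairEnergy_nonneg_of_natDegree_eq_zero_left hu.ne_zero (natDegree_eq_zero_of_isUnit hu)
  | mul p i hp0 hi ih =>
    rw [pairEnergy_mul_left hi.ne_zero hp0]
    refine add_nonneg ?_ (ih hp0)
    clear ih hp
    induction q using WfDvdMonoid.induction_on_irreducible with
    | zero => exact absurd rfl hq
    | unit u hu => exact pairEnergy_nonneg_of_natDegree_eq_zero_right hu.ne_zero (natDegree_eq_zero_of_isUnit hu)
    | mul q j hq0 hj ih =>
      rw [pairEnergy_mul_right hj.ne_zero hq0]
      exact add_nonneg (pairEnergy_nonneg_of_irreducible hi hj) (ih hq0)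

theorem logEnergy_roots_ge {f : ℤ[X]} (hf : f ≠ 0) :
    -(2 * f.natDegree * Real.log ‖(toComplex f).leadingCoeff‖) ≤
      logEnergy (toComplex f).roots (toComplex f).roots := by
  have := pairEnergy_nonneg hf hf
  rw [pairEnergy] at this
  linarith

/-- Every nonzero integer polynomial has an integer divisor with the same roots, all simple. -/
theorem exists_dvd_nodup_roots {f : ℤ[X]} (hf : f ≠ 0) :
    ∃ g : ℤ[X], g ∣ f ∧ (toComplex g).roots.Nodup ∧
      ∀ z, z ∈ (toComplex g).roots ↔ z ∈ (toComplex f).roots := by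
  induction f using WfDvdMonoid.induction_on_irreducible with
  | zero => exact absurd rfl hf
  | unit u hu =>
    have hr := roots_eq_zero_of_natDegree_eq_zero (natDegree_eq_zero_of_isUnit hu)
    exact ⟨u, dvd_rfl, by simp [hr], fun z => Iff.rfl⟩
  | mul f p hf0 hp ih =>
    obtain ⟨g, hgf, hnd, hmem⟩ := ih hf0
    have hg0 : g ≠ 0 := ne_zero_of_dvd_ne_zero hf0 hgf
    rw [roots_toComplex_mul hp.ne_zero hf0]
    by_cases hd : p.natDegree = 0
    · have hr := roots_eq_zero_of_natDegree_eq_zero hd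
      exact ⟨g, hgf.mul_left p, hnd, by simpa [hr] using hmem⟩
    -- Either p already divides g over ℚ and brings no new root, or it shares no root with g and can
    -- be multiplied in; its own roots are simple by separability.
    rcases isCoprime_toComplex_or_dvd (q := g) hp hd with h | h
    · refine ⟨g, hgf.mul_left p, hnd, fun z => ?_⟩
      rw [Multiset.mem_add, ← hmem]
      refine ⟨Or.inr, Or.rec (fun hz => ?_) id⟩
      have hdvd : toComplex p ∣ toComplex g := by
        rw [← map_toRat, ← map_toRat]
        exact Polynomial.map_dvd _ h
      exact Multiset.mem_of_le (roots.le_of_dvd (toComplex_ne_zero hg0) hdvd) hz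
    · refine ⟨p * g, mul_dvd_mul_left p hgf, ?_, fun z => ?_⟩
      · rw [roots_toComplex_mul hp.ne_zero hg0, Multiset.nodup_add]
        refine ⟨nodup_roots (isCoprime_derivative_of_irreducible hp hd), hnd, ?_⟩
        rw [Multiset.disjoint_left]
        intro z hz hz'
        exact eval_ne_zero_of_isCoprime h hz (mem_roots'.mp hz').2
      · rw [roots_toComplex_mul hp.ne_zero hg0, Multiset.mem_add, Multiset.mem_add, hmem]

/-! ### Davenport–Mahler bound for Vandermonde determinants -/

open Finset Matrix in
-- The operation is left multiplication by a unitriangular matrix. The one-sided condition on `t`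
-- ensures this; for arbitrary `t`, two rows could be subtracted from each other.
theorem det_sub_rows {m : ℕ} (A : Matrix (Fin m) (Fin m) ℂ) (S : Finset (Fin m))
    (t : Fin m → Fin m) (ht : (∀ i ∈ S, t i < i) ∨ (∀ i ∈ S, i < t i)) :
    (Matrix.of fun i k => A i k - if i ∈ S then A (t i) k else 0).det = A.det := by
  set L : Matrix (Fin m) (Fin m) ℂ :=
    Matrix.of fun i k => (if i = k then 1 else 0) - if i ∈ S ∧ t i = k then 1 else 0 with hL
  have hmul : (Matrix.of fun i k => A i k - if i ∈ S then A (t i) k else 0) = L * A := by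
    ext i k
    by_cases hi : i ∈ S <;> simp [hL, Matrix.mul_apply, sub_mul, hi]
  have hdiag : ∀ i, L i i = 1 := fun i => by
    have : ¬(i ∈ S ∧ t i = i) := fun ⟨hi, h⟩ => by
      rcases ht with ht | ht <;> exact absurd (ht i hi) (by simp [h])
    simp [hL, this]
  have hdet : L.det = 1 := by
    rcases ht with ht | ht
    · rw [det_of_isLowerTriangular, prod_eq_one fun i _ => hdiag i]
      intro i j hij
      have hij : i < j := hij
      have : ¬(i ∈ S ∧ t i = j) := fun ⟨hi, h⟩ => absurd (ht i hi) (by simpa [h] using hij.le)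
      simp [hL, this, hij.ne]
    · rw [det_of_isUpperTriangular, prod_eq_one fun i _ => hdiag i]
      intro i j hij
      have hij : j < i := hij
      have : ¬(i ∈ S ∧ t i = j) := fun ⟨hi, h⟩ => absurd (ht i hi) (by simpa [h] using hij.le)
      simp [hL, this, hij.ne']
  rw [hmul, det_mul, hdet, one_mul]

/-- As y lies within 1/m of x, its modulus is at most (1 + 1/m) max(1, |x|), and (1 + 1/m)^m ≤ e ≤
3. The bound therefore involves x alone, and there are at most m terms. -/
theorem norm_geom_sum₂_le {m k : ℕ} (hk : k < m) {x y : ℂ} (h : m * ‖x - y‖ ≤ 1) :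
    ‖∑ i ∈ Finset.range k, x ^ i * y ^ (k - 1 - i)‖ ≤ 3 * m * max 1 ‖x‖ ^ m := by
  have hm : (0 : ℝ) < m := by exact_mod_cast (Nat.zero_le k).trans_lt hk
  set M := max 1 ‖x‖
  have hM : 1 ≤ M := le_max_left _ _
  set R := (1 + 1 / (m : ℝ)) * M
  have hMR : M ≤ R := by
    have : 0 ≤ 1 / (m : ℝ) * M := by positivity
    simp only [R]; linarith
  have hx : ‖x‖ ≤ R := (le_max_right _ _).trans hMR
  have hy : ‖y‖ ≤ R := by
    have h1 : ‖y‖ ≤ ‖x‖ + ‖x - y‖ := by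
      have := norm_sub_le x (x - y)
      rwa [sub_sub_cancel] at this
    have h2 : ‖x - y‖ ≤ 1 / m := by rw [le_div_iff₀ hm]; linarith
    have h3 : 1 / (m : ℝ) * 1 ≤ 1 / (m : ℝ) * M := by gcongr
    have h4 : ‖x‖ ≤ M := le_max_right _ _
    simp only [R]; linarith
  have hR1 : 1 ≤ R := hM.trans hMR
  have hRm : R ^ m ≤ 3 * M ^ m := by
    rw [mul_pow]
    gcongr
    calc (1 + 1 / (m : ℝ)) ^ m ≤ Real.exp (1 / m) ^ m := by
          gcongr
          rw [add_comm]
          exact Real.add_one_le_exp _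
      _ = Real.exp 1 := by
          rw [← Real.exp_nat_mul, mul_one_div_cancel hm.ne']
      _ ≤ 3 := Real.exp_one_lt_three.le
  calc ‖∑ i ∈ Finset.range k, x ^ i * y ^ (k - 1 - i)‖
      ≤ ∑ i ∈ Finset.range k, R ^ m := by
        refine norm_sum_le_of_le _ fun i hi => ?_
        rw [norm_mul, norm_pow, norm_pow]
        calc ‖x‖ ^ i * ‖y‖ ^ (k - 1 - i) ≤ R ^ i * R ^ (k - 1 - i) := by gcongr
          _ = R ^ (i + (k - 1 - i)) := (pow_add _ _ _).symm
          _ ≤ R ^ m := by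
            refine pow_le_pow_right₀ hR1 ?_
            have := Finset.mem_range.mp hi
            omega
    _ = k * R ^ m := by simp
    _ ≤ m * (3 * M ^ m) := by gcongr
    _ = 3 * m * M ^ m := by ring

open Finset Matrix in
-- After the row subtraction, row i with i in `S` is divisible by v i - v (t i). Taking out also
-- max(1, |v i|)^m leaves entries of size at most 3m. This weight depends only on the row itself, so
-- it does not matter how many points share a neighbour.
theorem norm_det_vandermonde_le {m : ℕ} (v : Fin m → ℂ) (S : Finset (Fin m))
    (t : Fin m → Fin m) (ht : (∀ i ∈ S, t i < i) ∨ (∀ i ∈ S, i < t i))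
    (hs : ∀ i ∈ S, m * ‖v i - v (t i)‖ ≤ 1) :
    ‖(vandermonde v).det‖ ≤
      (∏ i ∈ S, ‖v i - v (t i)‖) * (∏ i, max 1 ‖v i‖) ^ m * (m.factorial * (3 * m : ℝ) ^ m) := by
  set M : Fin m → ℝ := fun i => max 1 ‖v i‖ with hMdef
  have hM1 : ∀ i, 1 ≤ M i := fun i => le_max_left _ _
  have hM0 : ∀ i, ((M i : ℂ) ^ m) ≠ 0 := fun i =>
    pow_ne_zero _ (Complex.ofReal_ne_zero.mpr (zero_lt_one.trans_le (hM1 i)).ne')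
  set N : Matrix (Fin m) (Fin m) ℂ := Matrix.of fun i k =>
    if i ∈ S then (∑ j ∈ range (k : ℕ), v i ^ j * v (t i) ^ ((k : ℕ) - 1 - j)) else v i ^ (k : ℕ)
    with hN
  set B : Matrix (Fin m) (Fin m) ℂ := Matrix.of fun i k => N i k / (M i : ℂ) ^ m with hB
  set c : Fin m → ℂ := fun i => (if i ∈ S then v i - v (t i) else 1) * (M i : ℂ) ^ m with hc
  have hfac : (Matrix.of fun i k => vandermonde v i k - if i ∈ S then vandermonde v (t i) k else 0)
      = Matrix.of fun i k => c i * B i k := by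
    ext i k
    simp only [of_apply, vandermonde_apply, hc, hB]
    rw [mul_assoc, mul_div_cancel₀ _ (hM0 i)]
    by_cases hi : i ∈ S
    · simp only [hi, if_true, hN, of_apply]
      rw [mul_comm, geom_sum₂_mul]
    · simp [hi, hN]
  have hm : ∀ _ : Fin m, (1 : ℝ) ≤ m := fun i => by
    exact_mod_cast (Nat.zero_le _).trans_lt i.2
  have hBle : ∀ i k, (IsAbsoluteValue.toAbsoluteValue (norm : ℂ → ℝ)) (B i k) ≤ 3 * m := by
    intro i k
    have hMm : (0 : ℝ) < M i ^ m := pow_pos (zero_lt_one.trans_le (hM1 i)) _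
    change ‖N i k / (M i : ℂ) ^ m‖ ≤ 3 * m
    rw [norm_div, norm_pow, Complex.norm_real, Real.norm_of_nonneg (zero_le_one.trans (hM1 i)),
      div_le_iff₀ hMm]
    by_cases hi : i ∈ S
    · simp only [hN, of_apply, hi, if_true]
      exact norm_geom_sum₂_le k.2 (hs i hi)
    · simp only [hN, of_apply, hi, if_false, norm_pow]
      calc ‖v i‖ ^ (k : ℕ) ≤ M i ^ (k : ℕ) := by gcongr; exact le_max_right _ _
        _ ≤ M i ^ m := pow_le_pow_right₀ (hM1 i) k.2.le
        _ ≤ 3 * m * M i ^ m := le_mul_of_one_le_left hMm.le (by linarith [hm i])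
  -- The Leibniz expansion gives m! (3m)^m; Hadamard's inequality is not needed, since only the
  -- order m log m of the logarithm matters.
  have hdetB := Matrix.det_le hBle
  rw [Fintype.card_fin, nsmul_eq_mul] at hdetB
  change ‖B.det‖ ≤ _ at hdetB
  rw [← det_sub_rows (vandermonde v) S t ht, hfac, det_mul_column, norm_mul]
  have hcprod : ‖∏ i, c i‖ = (∏ i ∈ S, ‖v i - v (t i)‖) * (∏ i, M i) ^ m := by
    simp only [hc, prod_mul_distrib, norm_mul, prod_pow, norm_pow, norm_prod, Complex.norm_real,
      Real.norm_of_nonneg (zero_le_one.trans (hM1 _))]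
    congr 1
    simp [apply_ite]
  rw [hcprod]
  gcongr

open Finset Matrix in
theorem two_mul_log_norm_det_vandermonde {m : ℕ} {v : Fin m → ℂ} (hv : Function.Injective v) :
    2 * Real.log ‖(vandermonde v).det‖ = ∑ i, ∑ j, Real.log ‖v i - v j‖ := by
  have hne : ∀ i, ∀ j ∈ Ioi i, ‖v j - v i‖ ≠ 0 := fun i j hij =>
    norm_ne_zero_iff.mpr (sub_ne_zero.mpr fun h => (mem_Ioi.mp hij).ne' (hv h))
  rw [det_vandermonde, norm_prod, Real.log_prod fun i _ => by
    rw [norm_prod]; exact prod_ne_zero_iff.mpr (hne i)]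
  simp_rw [norm_prod]
  rw [sum_congr rfl fun i _ => Real.log_prod (hne i), two_mul, ← sum_add_distrib]
  simp_rw [← sum_add_distrib]
  have h1 := sum_sum_Ioi_add_eq_sum_sum_off_diag fun i j : Fin m => Real.log ‖v i - v j‖
  have h2 : ∀ i : Fin m, ∑ j, Real.log ‖v i - v j‖ = ∑ j ∈ {i}ᶜ, Real.log ‖v j - v i‖ := by
    intro i
    rw [← sum_compl_add_sum {i}]
    simp [norm_sub_rev (v i)]
  rw [sum_congr rfl fun i _ => h2 i, ← h1]
  refine sum_congr rfl fun i _ => sum_congr rfl fun j _ => ?_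
  rw [norm_sub_rev (v i)]

open Finset Matrix in
theorem sum_neg_log_le_of_oriented {m : ℕ} {v : Fin m → ℂ} (hv : Function.Injective v)
    (S : Finset (Fin m)) (t : Fin m → Fin m)
    (ht : (∀ i ∈ S, t i < i) ∨ (∀ i ∈ S, i < t i)) (hs : ∀ i ∈ S, m * ‖v i - v (t i)‖ ≤ 1) :
    ∑ i ∈ S, -Real.log ‖v i - v (t i)‖ ≤
      m * ∑ i, Real.log (max 1 ‖v i‖) - (∑ i, ∑ j, Real.log ‖v i - v j‖) / 2 +
        (2 * m * Real.log m + m * Real.log 3) := by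
  rcases Nat.eq_zero_or_pos m with rfl | hm
  · simp [Finset.eq_empty_of_isEmpty S]
  have hm' : (0 : ℝ) < m := by exact_mod_cast hm
  have hdet0 : 0 < ‖(vandermonde v).det‖ := norm_pos_iff.mpr (det_vandermonde_ne_zero_iff.mpr hv)
  have hfac : (m.factorial : ℝ) ≤ (m : ℝ) ^ m := by exact_mod_cast Nat.factorial_le_pow m
  have hle := norm_det_vandermonde_le v S t ht hs
  have hSne : ∀ i ∈ S, ‖v i - v (t i)‖ ≠ 0 := fun i hi => by
    refine norm_ne_zero_iff.mpr (sub_ne_zero.mpr fun h => ?_)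
    have := hv h
    rcases ht with ht | ht <;> exact absurd (ht i hi) (by simp [← this])
  have hMne : ∀ i ∈ (univ : Finset (Fin m)), max 1 ‖v i‖ ≠ 0 := fun i _ =>
    (zero_lt_one.trans_le (le_max_left _ _)).ne'
  have hle' : ‖(vandermonde v).det‖ ≤
      (∏ i ∈ S, ‖v i - v (t i)‖) * (∏ i, max 1 ‖v i‖) ^ m * ((m : ℝ) ^ m * (3 * m : ℝ) ^ m) := by
    refine hle.trans ?_
    gcongr
  have hlog := Real.log_le_log hdet0 hle'
  have hP : (∏ i ∈ S, ‖v i - v (t i)‖) ≠ 0 := prod_ne_zero_iff.mpr hSne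
  have hQ : (∏ i, max 1 ‖v i‖) ^ m ≠ 0 := pow_ne_zero _ (prod_ne_zero_iff.mpr hMne)
  rw [Real.log_mul (mul_ne_zero hP hQ) (by positivity), Real.log_mul hP hQ, Real.log_prod hSne,
    Real.log_pow, Real.log_prod hMne, Real.log_mul (by positivity) (by positivity), Real.log_pow,
    Real.log_pow, Real.log_mul (by norm_num) hm'.ne'] at hlog
  have h2 := two_mul_log_norm_det_vandermonde hv
  rw [sum_neg_distrib]
  linarith

open Finset in
/-- **Davenport–Mahler bound** for an arbitrary choice `t` of a neighbour of each point. -/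
theorem sum_neg_log_le {m : ℕ} {v : Fin m → ℂ} (hv : Function.Injective v)
    (S : Finset (Fin m)) (t : Fin m → Fin m) (ht : ∀ i ∈ S, t i ≠ i)
    (hs : ∀ i ∈ S, m * ‖v i - v (t i)‖ ≤ 1) :
    ∑ i ∈ S, -Real.log ‖v i - v (t i)‖ ≤
      2 * m * ∑ i, Real.log (max 1 ‖v i‖) - ∑ i, ∑ j, Real.log ‖v i - v j‖ +
        (4 * m * Real.log m + 2 * m * Real.log 3) := by
  -- Splitting by the direction of `t` makes each half triangular. Each half costs one Vandermonde
  -- determinant, hence the doubled constants and the full energy rather than half of it.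
  have h1 := sum_neg_log_le_of_oriented hv (S.filter fun i => t i < i) t
    (Or.inl fun i hi => (mem_filter.mp hi).2) fun i hi => hs i (mem_filter.mp hi).1
  have h2 := sum_neg_log_le_of_oriented hv (S.filter fun i => ¬ t i < i) t
    (Or.inr fun i hi => lt_of_le_of_ne (not_lt.mp (mem_filter.mp hi).2)
      (ht i (mem_filter.mp hi).1).symm) fun i hi => hs i (mem_filter.mp hi).1
  rw [← sum_filter_add_sum_filter_not S fun i => t i < i]
  linarith

/-! ### Separations and the Mahler measure -/

theorem exists_sep_eq {f : ℂ[X]} {z : ℂ} (h : ∃ y ∈ roots f, y ≠ z) :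
    ∃ y ∈ roots f, y ≠ z ∧ sep f z = ‖z - y‖ := by
  have hfin : ((fun y : ℂ => ‖y - z‖) '' {y : ℂ | y ∈ roots f ∧ y ≠ z}).Finite :=
    ((roots f).finite_toSet.subset fun y hy => hy.1).image _
  obtain ⟨y₀, hy₀, hne₀⟩ := h
  obtain ⟨y, ⟨hy, hne⟩, hyz⟩ :=
    Set.Nonempty.csInf_mem (⟨_, y₀, ⟨hy₀, hne₀⟩, rfl⟩ :
      ((fun y : ℂ => ‖y - z‖) '' {y : ℂ | y ∈ roots f ∧ y ≠ z}).Nonempty) hfin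
  exact ⟨y, hy, hne, by rw [sep, ← hyz, norm_sub_rev]⟩

theorem sep_eq_zero {f : ℂ[X]} {z : ℂ} (h : ¬∃ y ∈ roots f, y ≠ z) : sep f z = 0 := by
  have : {y : ℂ | y ∈ roots f ∧ y ≠ z} = ∅ :=
    Set.eq_empty_of_forall_notMem fun y hy => h ⟨y, hy.1, hy.2⟩
  rw [sep, this, Set.image_empty, Real.sInf_empty]

theorem sum_map_nonneg {s : Multiset ℂ} {φ : ℂ → ℝ} (h : ∀ x, 0 ≤ φ x) : 0 ≤ (s.map φ).sum :=
  Multiset.sum_nonneg fun _ hx => by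
    obtain ⟨y, -, rfl⟩ := Multiset.mem_map.mp hx
    exact h y

theorem le_sum_map {s : Multiset ℂ} {φ : ℂ → ℝ} (h : ∀ x, 0 ≤ φ x) {x : ℂ} (hx : x ∈ s) :
    φ x ≤ (s.map φ).sum := by
  obtain ⟨t, rfl⟩ := Multiset.exists_cons_of_mem hx
  rw [Multiset.map_cons, Multiset.sum_cons]
  linarith [sum_map_nonneg (s := t) h]

theorem logMahlerMeasure_eq (p : ℂ[X]) :
    p.logMahlerMeasure =
      Real.log ‖p.leadingCoeff‖ + (p.roots.map fun x => Real.log (max 1 ‖x‖)).sum := by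
  rw [logMahlerMeasure_eq_log_leadingCoeff_add_sum_log_roots]
  simp_rw [Real.posLog_eq_log_max_one (norm_nonneg _)]

theorem log_max_one_nonneg (x : ℂ) : 0 ≤ Real.log (max 1 ‖x‖) :=
  Real.log_nonneg (le_max_left _ _)

theorem logMahlerMeasure_nonneg {f : ℤ[X]} (hf : f ≠ 0) :
    0 ≤ (toComplex f).logMahlerMeasure := by
  rw [logMahlerMeasure_eq]
  exact add_nonneg (log_leadingCoeff_nonneg hf) (sum_map_nonneg log_max_one_nonneg)

theorem log_max_one_le_logMahlerMeasure {f : ℤ[X]} (hf : f ≠ 0) {x : ℂ}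
    (hx : x ∈ (toComplex f).roots) :
    Real.log (max 1 ‖x‖) ≤ (toComplex f).logMahlerMeasure := by
  rw [logMahlerMeasure_eq]
  have := le_sum_map log_max_one_nonneg hx
  linarith [log_leadingCoeff_nonneg hf]

theorem logMahlerMeasure_le_of_dvd {f g : ℤ[X]} (hf : f ≠ 0) (h : g ∣ f) :
    (toComplex g).logMahlerMeasure ≤ (toComplex f).logMahlerMeasure := by
  obtain ⟨q, rfl⟩ := h
  have hq := right_ne_zero_of_mul hf
  have hg := left_ne_zero_of_mul hf
  rw [toComplex, toComplex, Polynomial.map_mul, logMahlerMeasure_mul_eq_add_logMahlerMeasure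
    (mul_ne_zero (toComplex_ne_zero hg) (toComplex_ne_zero hq))]
  linarith [logMahlerMeasure_nonneg hq]

theorem logMahlerMeasure_le_of_hasMagnitude {f : ℤ[X]} {n : ℕ} {τ : ℝ} (hf : f ≠ 0)
    (h : HasMagnitude f n τ) :
    (toComplex f).logMahlerMeasure ≤ Real.log (n + 1) + τ * Real.log 2 := by
  have hle : (toComplex f).mahlerMeasure ≤ (n + 1) * (2 : ℝ) ^ τ := by
    refine (mahlerMeasure_le_sum_norm_coeff _).trans ?_
    calc (toComplex f).sum (fun _ a => ‖a‖)
        ≤ ∑ _i ∈ (toComplex f).support, (2 : ℝ) ^ τ := by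
          refine Finset.sum_le_sum fun i _ => ?_
          have := h.2 i
          simpa using this
      _ = (toComplex f).support.card * (2 : ℝ) ^ τ := by simp
      _ ≤ (n + 1) * (2 : ℝ) ^ τ := by
          gcongr
          have := (card_supp_le_succ_natDegree (toComplex f)).trans
            (Nat.succ_le_succ ((natDegree_toComplex f).trans_le h.1))
          exact_mod_cast this
  have h2 : (0 : ℝ) < 2 ^ τ := by positivity
  rw [logMahlerMeasure_eq_log_MahlerMeasure, ← Real.log_rpow two_pos,
    ← Real.log_mul (by positivity) h2.ne']
  exact Real.log_le_log (mahlerMeasure_pos_of_ne_zero (toComplex_ne_zero hf)) hle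

theorem log_norm_sub_le (x y : ℂ) :
    Real.log ‖x - y‖ ≤ Real.log 2 + Real.log (max 1 ‖x‖) + Real.log (max 1 ‖y‖) := by
  have hx : 1 ≤ max 1 ‖x‖ := le_max_left _ _
  have hy : 1 ≤ max 1 ‖y‖ := le_max_left _ _
  rcases eq_or_ne x y with rfl | hne
  · rw [sub_self, norm_zero, Real.log_zero]
    have := Real.log_nonneg one_le_two
    linarith [log_max_one_nonneg x]
  rw [← Real.log_mul two_ne_zero (by positivity), ← Real.log_mul (by positivity) (by positivity)]
  refine Real.log_le_log (norm_pos_iff.mpr (sub_ne_zero.mpr hne)) ((norm_sub_le x y).trans ?_)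
  have hx' : ‖x‖ ≤ max 1 ‖x‖ := le_max_right _ _
  have hy' : ‖y‖ ≤ max 1 ‖y‖ := le_max_right _ _
  nlinarith

theorem mem_roots_iff {f : ℂ[X]} {z : ℂ} : z ∈ roots f ↔ z ∈ f.roots :=
  Multiset.mem_toFinset

theorem max_log_sep_le {f : ℤ[X]} (hf : f ≠ 0) {z : ℂ} (hz : z ∈ (toComplex f).roots) :
    max 0 (Real.log (sep (toComplex f) z)) ≤
      Real.log 2 + 2 * (toComplex f).logMahlerMeasure := by
  have h2 := Real.log_nonneg one_le_two
  refine max_le (by linarith [logMahlerMeasure_nonneg hf]) ?_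
  by_cases h : ∃ y ∈ roots (toComplex f), y ≠ z
  · obtain ⟨y, hy, -, hs⟩ := exists_sep_eq h
    rw [hs]
    linarith [log_norm_sub_le z y, log_max_one_le_logMahlerMeasure hf hz,
      log_max_one_le_logMahlerMeasure hf (mem_roots_iff.mp hy)]
  · rw [sep_eq_zero h, Real.log_zero]
    linarith [logMahlerMeasure_nonneg hf]

theorem abs_le_max_add_max (t : ℝ) : |t| ≤ max 0 t + max 0 (-t) := by
  rcases le_total 0 t with h | h
  · rw [abs_of_nonneg h]
    linarith [le_max_right 0 t, le_max_left 0 (-t)]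
  · rw [abs_of_nonpos h]
    linarith [le_max_left 0 t, le_max_right 0 (-t)]

/-! ### The bound with multiplicities -/

/-- `log (‖x - y‖ / (2 max(1, ‖x‖) max(1, ‖y‖)))`, up to the convention `log 0 = 0`. -/
noncomputable def chordLog (x y : ℂ) : ℝ :=
  Real.log ‖x - y‖ - (Real.log 2 + Real.log (max 1 ‖x‖) + Real.log (max 1 ‖y‖))

theorem chordLog_nonpos (x y : ℂ) : chordLog x y ≤ 0 :=
  sub_nonpos.mpr (log_norm_sub_le x y)

theorem sum_chordLog_le {s : Multiset ℂ} {x y : ℂ} (hy : y ∈ s) :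
    (s.map (chordLog x)).sum ≤ chordLog x y := by
  have := le_sum_map (fun y => neg_nonneg.mpr (chordLog_nonpos x y)) hy
  rw [Multiset.sum_map_neg] at this
  linarith

/-- All values of `chordLog` are nonpositive, so the sum over all roots, z included, lies below the
single term of a nearest root. This loses only the normalisation of the other terms. -/
theorem max_neg_log_sep_le {f : ℂ[X]} (z : ℂ) :
    max 0 (-Real.log (sep f z)) ≤ -(f.roots.map (chordLog z)).sum := by
  have h0 : 0 ≤ -(f.roots.map (chordLog z)).sum := by
    rw [← Multiset.sum_map_neg]
    exact sum_map_nonneg fun y => neg_nonneg.mpr (chordLog_nonpos z y)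
  refine max_le h0 ?_
  by_cases h : ∃ y ∈ roots f, y ≠ z
  · obtain ⟨y, hy, -, hs⟩ := exists_sep_eq h
    have h1 := sum_chordLog_le (x := z) (mem_roots_iff.mp hy)
    have h2 : chordLog z y ≤ Real.log ‖z - y‖ := by
      rw [chordLog]
      linarith [Real.log_nonneg one_le_two, log_max_one_nonneg z, log_max_one_nonneg y]
    rw [hs]
    linarith
  · rwa [sep_eq_zero h, Real.log_zero, neg_zero]

theorem sum_chordLog_eq (s : Multiset ℂ) :
    (s.map fun x => (s.map (chordLog x)).sum).sum =
      logEnergy s s - ((s.card : ℝ) ^ 2 * Real.log 2 +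
        2 * s.card * (s.map fun x => Real.log (max 1 ‖x‖)).sum) := by
  have hrow : ∀ x, (s.map (chordLog x)).sum = (s.map fun y => Real.log ‖x - y‖).sum -
      (s.map fun y => Real.log 2 + Real.log (max 1 ‖x‖) + Real.log (max 1 ‖y‖)).sum :=
    fun x => Multiset.sum_map_sub
  simp only [hrow, logEnergy, Multiset.sum_map_sub, Multiset.sum_map_add, Multiset.map_const',
    Multiset.sum_replicate, nsmul_eq_mul, Multiset.sum_map_mul_left]
  ring

theorem sum_map_max_neg_log_sep_le {f : ℤ[X]} (hf : f ≠ 0) :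
    ((toComplex f).roots.map fun z => max 0 (-Real.log (sep (toComplex f) z))).sum ≤
      (f.natDegree : ℝ) ^ 2 * Real.log 2 +
        2 * f.natDegree * (toComplex f).logMahlerMeasure := by
  have h1 := Multiset.sum_map_le_sum_map (s := (toComplex f).roots)
    (fun z => max 0 (-Real.log (sep (toComplex f) z)))
    (fun z => -((toComplex f).roots.map (chordLog z)).sum) fun z _ => max_neg_log_sep_le z
  rw [Multiset.sum_map_neg, sum_chordLog_eq, card_roots_toComplex] at h1
  rw [logMahlerMeasure_eq]
  linarith [logEnergy_roots_ge hf]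

theorem sum_mult_abs_log_sep_le {f : ℤ[X]} (hf : f ≠ 0) :
    ∑ z ∈ roots (toComplex f),
        ((toComplex f).rootMultiplicity z : ℝ) * |Real.log (sep (toComplex f) z)| ≤
      f.natDegree * (Real.log 2 + 2 * (toComplex f).logMahlerMeasure) +
      ((f.natDegree : ℝ) ^ 2 * Real.log 2 +
        2 * f.natDegree * (toComplex f).logMahlerMeasure) := by
  have hsum : ∑ z ∈ roots (toComplex f),
        ((toComplex f).rootMultiplicity z : ℝ) * |Real.log (sep (toComplex f) z)| =
      ((toComplex f).roots.map fun z => |Real.log (sep (toComplex f) z)|).sum := by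
    rw [Finset.sum_multiset_map_count]
    exact Finset.sum_congr rfl fun z _ => by rw [count_roots, nsmul_eq_mul]
  rw [hsum]
  refine (Multiset.sum_map_le_sum_map _ _ fun z _ => abs_le_max_add_max _).trans ?_
  rw [Multiset.sum_map_add]
  refine add_le_add ?_ (sum_map_max_neg_log_sep_le hf)
  refine (Multiset.sum_map_le_sum_map _ _ fun z hz => max_log_sep_le hf hz).trans ?_
  rw [Multiset.map_const', Multiset.sum_replicate, card_roots_toComplex, nsmul_eq_mul]

/-! ### The bound without multiplicities -/

theorem mul_log_le_mul_log {a b : ℕ} (h : a ≤ b) :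
    (a : ℝ) * Real.log a ≤ b * Real.log b := by
  rcases Nat.eq_zero_or_pos a with rfl | ha
  · simpa using mul_nonneg (Nat.cast_nonneg (α := ℝ) b) (Real.log_natCast_nonneg b)
  · have : Real.log a ≤ Real.log b :=
      Real.log_le_log (by exact_mod_cast ha) (by exact_mod_cast h)
    have := Real.log_natCast_nonneg a
    gcongr

theorem exists_enumeration (R : Finset ℂ) :
    ∃ v : Fin R.card → ℂ, Function.Injective v ∧ (∀ z, z ∈ R ↔ ∃ i, v i = z) ∧
      ∀ φ : ℂ → ℝ, ∑ i, φ (v i) = ∑ z ∈ R, φ z := by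
  refine ⟨fun i => R.equivFin.symm i, Subtype.val_injective.comp R.equivFin.symm.injective,
    fun z => ⟨fun hz => ⟨R.equivFin ⟨z, hz⟩, by simp⟩, ?_⟩, fun φ => ?_⟩
  · rintro ⟨i, rfl⟩
    exact (R.equivFin.symm i).2
  · rw [← Finset.sum_coe_sort R, ← R.equivFin.symm.sum_comp]

/-- Separations depend only on the set of roots, so the Vandermonde bound and the energy bound are
applied to g, which has integer coefficients, simple roots and Mahler measure at most that of f. -/
theorem sum_max_neg_log_sep_le {f : ℤ[X]} (hf : f ≠ 0) :
    ∑ z ∈ roots (toComplex f), max 0 (-Real.log (sep (toComplex f) z)) ≤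
      2 * f.natDegree * (toComplex f).logMahlerMeasure +
        (5 * f.natDegree * Real.log f.natDegree + 2 * f.natDegree * Real.log 3) := by
  classical
  obtain ⟨g, hgf, hnd, hmem⟩ := exists_dvd_nodup_roots hf
  have hg : g ≠ 0 := ne_zero_of_dvd_ne_zero hf hgf
  set R := roots (toComplex f)
  obtain ⟨v, hv, hvR, hsum⟩ := exists_enumeration R
  have hgR : (toComplex g).roots = R.val :=
    (Multiset.Nodup.ext hnd R.nodup).mpr fun z => (hmem z).trans mem_roots_iff.symm
  have hcard : g.natDegree = R.card := by rw [← card_roots_toComplex, hgR, Finset.card_val]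
  have hle : R.card ≤ f.natDegree := by
    rw [← hcard]
    exact natDegree_le_of_dvd hgf hf
  -- The index `j` is that of a nearest other root; if there is none, `i` serves as a dummy value
  -- and is kept out of `S`.
  have hnb : ∀ i, ∃ j, (∃ y ∈ R, y ≠ v i) → j ≠ i ∧ sep (toComplex f) (v i) = ‖v i - v j‖ := by
    intro i
    by_cases h : ∃ y ∈ R, y ≠ v i
    · obtain ⟨y, hy, hne, hs⟩ := exists_sep_eq h
      obtain ⟨j, rfl⟩ := (hvR y).mp hy
      exact ⟨j, fun _ => ⟨fun h => hne (by rw [h]), hs⟩⟩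
    · exact ⟨i, fun h' => absurd h' h⟩
  choose t ht using hnb
  set S : Finset (Fin R.card) := Finset.univ.filter fun i =>
    (∃ y ∈ R, y ≠ v i) ∧ R.card * ‖v i - v (t i)‖ ≤ 1 with hS
  have hbound := sum_neg_log_le hv S t (fun i hi => (ht i (Finset.mem_filter.mp hi).2.1).1)
    fun i hi => (Finset.mem_filter.mp hi).2.2
  -- With m distinct roots, the Vandermonde bound handles the separations up to 1/m, and any larger
  -- one costs at most log m. This adds m log m to the 4m log m already present, hence the 5.
  have hterm : ∀ i, max 0 (-Real.log (sep (toComplex f) (v i))) ≤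
      Real.log R.card + if i ∈ S then -Real.log ‖v i - v (t i)‖ else 0 := by
    intro i
    have hlogm := Real.log_natCast_nonneg R.card
    have hm : (1 : ℝ) ≤ R.card := by exact_mod_cast (Nat.zero_le _).trans_lt i.2
    by_cases h : ∃ y ∈ R, y ≠ v i
    · obtain ⟨hne, hs⟩ := ht i h
      have hpos : 0 < ‖v i - v (t i)‖ :=
        norm_pos_iff.mpr (sub_ne_zero.mpr fun h => hne (hv h).symm)
      rw [hs]
      by_cases hi : R.card * ‖v i - v (t i)‖ ≤ 1
      · rw [if_pos (Finset.mem_filter.mpr ⟨Finset.mem_univ _, h, hi⟩)]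
        have : Real.log ‖v i - v (t i)‖ ≤ 0 :=
          Real.log_nonpos hpos.le ((le_mul_of_one_le_left hpos.le hm).trans hi)
        exact max_le (by linarith) (by linarith)
      · rw [if_neg fun h' => hi (Finset.mem_filter.mp h').2.2, add_zero]
        refine max_le hlogm ?_
        have := Real.log_nonneg (not_le.mp hi).le
        rw [Real.log_mul (by positivity) hpos.ne'] at this
        linarith
    · rw [sep_eq_zero h, if_neg fun h' => h (Finset.mem_filter.mp h').2.1]
      simpa using hlogm
  have henergy : ∑ i, ∑ j, Real.log ‖v i - v j‖ =
      logEnergy (toComplex g).roots (toComplex g).roots := by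
    rw [hgR, logEnergy, hsum fun x => ∑ j, Real.log ‖x - v j‖]
    exact Finset.sum_congr rfl fun x _ => hsum fun y => Real.log ‖x - y‖
  have hmax : ∑ i, Real.log (max 1 ‖v i‖) =
      ((toComplex g).roots.map fun x => Real.log (max 1 ‖x‖)).sum := by
    rw [hgR, hsum fun x => Real.log (max 1 ‖x‖)]
    rfl
  have hE := logEnergy_roots_ge hg
  have hM := logMahlerMeasure_eq (toComplex g)
  have hMle := logMahlerMeasure_le_of_dvd hf hgf
  have hMnn := logMahlerMeasure_nonneg hg
  have hle' : (R.card : ℝ) ≤ f.natDegree := by exact_mod_cast hle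
  rw [← hsum fun z => max 0 (-Real.log (sep (toComplex f) z))]
  refine (Finset.sum_le_sum fun i _ => hterm i).trans ?_
  rw [Finset.sum_add_distrib, Finset.sum_ite_mem, Finset.univ_inter, Finset.sum_const,
    Finset.card_univ, Fintype.card_fin, nsmul_eq_mul]
  rw [henergy, hmax] at hbound
  rw [hcard] at hE
  -- The term 2m log|lc g| from the energy bound joins 2m ∑ log max(1, |x|) from the Vandermonde
  -- bound to give exactly 2m log M(g).
  have h1 : (R.card : ℝ) * (toComplex g).logMahlerMeasure ≤
      f.natDegree * (toComplex f).logMahlerMeasure := by gcongr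
  have h2 := mul_log_le_mul_log hle
  have h3 : (R.card : ℝ) * Real.log 3 ≤ f.natDegree * Real.log 3 :=
    mul_le_mul_of_nonneg_right hle' (Real.log_nonneg (by norm_num))
  rw [hM, mul_add] at h1
  linarith

theorem sum_abs_log_sep_le {f : ℤ[X]} (hf : f ≠ 0) :
    ∑ z ∈ roots (toComplex f), |Real.log (sep (toComplex f) z)| ≤
      f.natDegree * (Real.log 2 + 2 * (toComplex f).logMahlerMeasure) +
      (2 * f.natDegree * (toComplex f).logMahlerMeasure +
        (5 * f.natDegree * Real.log f.natDegree + 2 * f.natDegree * Real.log 3)) := by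
  refine (Finset.sum_le_sum fun z _ => abs_le_max_add_max _).trans ?_
  rw [Finset.sum_add_distrib]
  refine add_le_add ?_ (sum_max_neg_log_sep_le hf)
  refine (Finset.sum_le_sum fun z hz => max_log_sep_le hf (mem_roots_iff.mp hz)).trans ?_
  rw [Finset.sum_const, nsmul_eq_mul]
  have hcard : ((roots (toComplex f)).card : ℝ) ≤ f.natDegree := by
    rw [← card_roots_toComplex]
    exact_mod_cast Multiset.toFinset_card_le _
  have := logMahlerMeasure_nonneg hf
  have := Real.log_nonneg one_le_two
  gcongr

/-! ### Explicit bounds in base `2` -/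

theorem abs_logb_two (x : ℝ) : |Real.logb 2 x| = |Real.log x| / Real.log 2 := by
  rw [Real.logb, abs_div, abs_of_pos (Real.log_pos one_lt_two)]

theorem one_le_logb_two_add {x : ℝ} (hx : 0 ≤ x) : 1 ≤ Real.logb 2 (2 + x) := by
  rw [Real.le_logb_iff_rpow_le one_lt_two (by linarith), Real.rpow_one]
  linarith

theorem log_eq_logb_two_mul (x : ℝ) : Real.log x = Real.logb 2 x * Real.log 2 := by
  rw [Real.logb, div_mul_cancel₀ _ (Real.log_pos one_lt_two).ne']

theorem logsepStar_le {n : ℕ} {τ : ℝ} (hn : 1 ≤ n) (hτ : 1 ≤ τ) {f : ℤ[X]} (hf : f ≠ 0)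
    (h : HasMagnitude f n τ) :
    logsepStar (toComplex f) ≤ 18 * (n * τ) * Real.logb 2 (2 + n * τ) := by
  have hn' : (1 : ℝ) ≤ n := by exact_mod_cast hn
  have hnτ : (n : ℝ) ≤ n * τ := le_mul_of_one_le_right (by linarith) hτ
  have hl2 := Real.log_pos one_lt_two
  set L := Real.logb 2 (2 + n * τ)
  have hL : 1 ≤ L := one_le_logb_two_add (by linarith)
  have hmul : (n : ℝ) * τ ≤ n * τ * L := le_mul_of_one_le_right (by linarith) hL
  rw [logsepStar_eq (toComplex_ne_zero hf)]
  refine max_le (by linarith) ?_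
  simp_rw [abs_logb_two]
  rw [← Finset.sum_div, div_le_iff₀ hl2]
  refine (sum_abs_log_sep_le hf).trans ?_
  have hd : (f.natDegree : ℝ) ≤ n := by exact_mod_cast h.1
  have hM0 := logMahlerMeasure_nonneg hf
  have hlogn : Real.log (n + 1) ≤ L * Real.log 2 := by
    rw [← log_eq_logb_two_mul]
    exact Real.log_le_log (by linarith) (by linarith)
  have hM : (toComplex f).logMahlerMeasure ≤ (L + τ) * Real.log 2 := by
    linarith [logMahlerMeasure_le_of_hasMagnitude hf h]
  have hlogd := mul_log_le_mul_log h.1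
  have hlogn' : Real.log n ≤ L * Real.log 2 :=
    (Real.log_le_log (by linarith) (by linarith)).trans hlogn
  have hlog3 : Real.log 3 ≤ 2 * Real.log 2 := by
    rw [← Real.log_rpow two_pos]
    exact Real.log_le_log (by norm_num) (by norm_num)
  have h1 : (f.natDegree : ℝ) * (toComplex f).logMahlerMeasure ≤ n * ((L + τ) * Real.log 2) := by
    gcongr
  have h2 : (f.natDegree : ℝ) * Real.log f.natDegree ≤ n * (L * Real.log 2) :=
    hlogd.trans (by gcongr)
  have h3 : (f.natDegree : ℝ) * Real.log 3 ≤ n * (2 * Real.log 2) := by gcongr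
  have h4 : (f.natDegree : ℝ) * Real.log 2 ≤ n * Real.log 2 := by gcongr
  have h5 : (n : ℝ) * L ≤ n * τ * L := by gcongr
  -- In units of log 2, with log M(f) ≤ L + τ and log 3 ≤ 2: 1 + 2·2 copies of n, 2 + 2 + 5 of nL
  -- and 2 + 2 of nτ. Each of the three is at most nτL, hence 18.
  have h6 : 5 * n + 9 * (n * L) + 4 * (n * τ) ≤ 18 * (n * τ) * L := by linarith
  have h7 := mul_le_mul_of_nonneg_right h6 hl2.le
  linarith

theorem logsep_le {n : ℕ} {τ : ℝ} (hn : 1 ≤ n) (hτ : 1 ≤ τ) {f : ℤ[X]} (hf : f ≠ 0)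
    (h : HasMagnitude f n τ) :
    logsep (toComplex f) ≤
      8 * (n * τ + (n : ℝ) ^ 2) * Real.logb 2 (2 + (n * τ + (n : ℝ) ^ 2)) := by
  have hn' : (1 : ℝ) ≤ n := by exact_mod_cast hn
  have hnτ : (n : ℝ) ≤ n * τ := le_mul_of_one_le_right (by linarith) hτ
  have hnn : (n : ℝ) ≤ (n : ℝ) ^ 2 := le_self_pow₀ hn' two_ne_zero
  have hl2 := Real.log_pos one_lt_two
  set Q := n * τ + (n : ℝ) ^ 2 with hQ
  set L := Real.logb 2 (2 + Q)
  have hL : 1 ≤ L := one_le_logb_two_add (by linarith)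
  have hmul : Q ≤ Q * L := le_mul_of_one_le_right (by linarith) hL
  rw [logsep]
  refine max_le (by linarith) ?_
  simp_rw [abs_logb_two, ← mul_div_assoc]
  rw [← Finset.sum_div, div_le_iff₀ hl2]
  refine (sum_mult_abs_log_sep_le hf).trans ?_
  have hd : (f.natDegree : ℝ) ≤ n := by exact_mod_cast h.1
  have hM0 := logMahlerMeasure_nonneg hf
  have hlogn : Real.log (n + 1) ≤ L * Real.log 2 := by
    rw [← log_eq_logb_two_mul]
    exact Real.log_le_log (by linarith) (by linarith)
  have hM : (toComplex f).logMahlerMeasure ≤ (L + τ) * Real.log 2 := by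
    linarith [logMahlerMeasure_le_of_hasMagnitude hf h]
  have h1 : (f.natDegree : ℝ) * (toComplex f).logMahlerMeasure ≤ n * ((L + τ) * Real.log 2) := by
    gcongr
  have h2 : (f.natDegree : ℝ) ^ 2 * Real.log 2 ≤ (n : ℝ) ^ 2 * Real.log 2 := by gcongr
  have h4 : (f.natDegree : ℝ) * Real.log 2 ≤ n * Real.log 2 := by gcongr
  have h5 : (n : ℝ) * L ≤ Q * L := by gcongr; linarith
  -- Half of the 8 absorbs 4nL, as n ≤ Q; the other half absorbs the rest, as n ≤ n² and L ≥ 1.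
  have h6 : n + (n : ℝ) ^ 2 + 4 * (n * L) + 4 * (n * τ) ≤ 8 * Q * L := by linarith
  have h7 := mul_le_mul_of_nonneg_right h6 hl2.le
  linarith

end RootSep

theorem mainTheorem8 :
    (∃ (C : ℝ) (k : ℕ), ∀ (n : ℕ) (τ : ℝ), 1 ≤ n → 1 ≤ τ →
      ∀ f : Polynomial ℤ, f ≠ 0 → RootSep.HasMagnitude f n τ →
        RootSep.logsepStar (f.map (Int.castRingHom ℂ)) ≤
          C * ((n : ℝ) * τ) * Real.logb 2 (2 + (n : ℝ) * τ) ^ k) ∧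
    (∃ (C : ℝ) (k : ℕ), ∀ (n : ℕ) (τ : ℝ), 1 ≤ n → 1 ≤ τ →
      ∀ f : Polynomial ℤ, f ≠ 0 → RootSep.HasMagnitude f n τ →
        RootSep.logsep (f.map (Int.castRingHom ℂ)) ≤
          C * ((n : ℝ) * τ + (n : ℝ) ^ 2) *
            Real.logb 2 (2 + ((n : ℝ) * τ + (n : ℝ) ^ 2)) ^ k) := by
  refine ⟨⟨18, 1, fun n τ hn hτ f hf h => ?_⟩, ⟨8, 1, fun n τ hn hτ f hf h => ?_⟩⟩
  · rw [pow_one]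
    exact RootSep.logsepStar_le hn hτ hf h
  · rw [pow_one]
    exact RootSep.logsep_le hn hτ hf h
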